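/- Let $p\in(0,1)$. For an integer $x\ge 1$ let $m(x)$ be the largest $m$ with $3^m\mid x$. Set $p(0,1)=1$, and for $x\ge1$ set $p(x,x-1)=1-p$, $p(x,x+1)=p$ if $3^{-m(x)}x\equiv1\pmod 3$, and $p(x,x-1)=p$, $p(x,x+1)=1-p$ if $3^{-m(x)}x\equiv2\pmod 3$. For $l\ge0$, on functions $f:\{0,1,\dots,3^l\}\to\mathbb C$, define the level-$l$ Laplacian $\Delta_p^{(l)}$ and, for $\beta,\alpha,\theta\in\mathbb R$, the level-$l$ truncated self-similar almost Mathieu operator $H^{(l)}_{p,\beta,\alpha,\theta}$ by $$(\Delta_p^{(l)}f)(x)=f(x)-(Pf)(x),\qquad (H^{(l)}_{p,\beta,\alpha,\theta}f)(x)=\beta\cos(2\pi\alpha x+\theta)f(x)-(Pf)(x),$$ where $(Pf)(0)=f(1)$, $(Pf)(3^l)=f(3^l-1)$, and $(Pf)(x)=p(x,x-1)f(x-1)+p(x,x+1)f(x+1)$ for $0<x<3^l$. In particular $\Delta^{(0)}:=\Delta_p^{(0)}=\begin{pmatrix}1&-1\\-1&1\end{pmatrix}$, so $\sigma(\Delta^{(0)})=\{0,2\}$.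 Here $\sigma$ denotes the spectrum, as a subset of $\mathbb C$. **Theorem.** Let $p\in(0,1)$, $\beta\in\mathbb R$, $n\ge1$, $k\in\{0,\dots,3^n-1\}$, and put $\theta=0$, $\alpha=k/3^n$. There is a polynomial $R=R_{p,\beta,k/3^n,0}$ with real coefficients, of degree $3^n$ and not depending on $l$, such that for every $l\ge n$ $$\sigma\big(H^{(l)}_{p,\beta,k/3^n,0}\big)=R^{-1}\Big(\sigma(\Delta_p^{(l-n)})\setminus\sigma(\Delta^{(0)})\Big)\cup\sigma\big(H^{(n)}_{p,\beta,k/3^n,0}\big),$$ where $R^{-1}(\cdot)$ is the preimage in $\mathbb C$. Furthermore, for $n=1$ and $k\in\{1,2\}$ this polynomial is $$R(z)=\frac{(-\beta+2p-2z)\,(\beta^2+2\beta p+\beta z-2pz-2p-2z^2+2)}{4p(1-p)}.$$ -/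

import Mathlib

/-- Transition probabilities `p(x, y)` of the self-similar random walk on the half-line
`ℤ₊ = {0, 1, 2, …}` reflected at `0`. For `x ≥ 1`, `padicValNat 3 x` is the largest `m` with
`3 ^ m ∣ x`; the walk steps left / right with probabilities `1 - p` / `p` if
`3 ^ (-m) * x ≡ 1 (mod 3)` and `p` / `1 - p` if `3 ^ (-m) * x ≡ 2 (mod 3)`. -/
noncomputable def transProb (p : ℝ) (x y : ℕ) : ℝ :=
  if x = 0 then (if y = 1 then 1 else 0)
  else if x / 3 ^ padicValNat 3 x % 3 = 1 then
    (if y + 1 = x then 1 - p else if y = x + 1 then p else 0)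
  else
    (if y + 1 = x then p else if y = x + 1 then 1 - p else 0)

/-- Transition probabilities on the vertex set `{0, …, 3 ^ l}` of the level-`l` graph: those of the
half-line, with a reflecting boundary condition imposed at the vertex `3 ^ l`. -/
noncomputable def truncProb (p : ℝ) (l x y : ℕ) : ℝ :=
  if x = 3 ^ l then (if y + 1 = x then 1 else 0) else transProb p x y

/-- The level-`l` probabilistic graph Laplacian `Δ_p^{(l)}`, as a matrix in the canonical basis
`δ_0, …, δ_{3^l}`: `(Δ f)(x) = f x - ∑ y, p(x, y) f y`. -/
noncomputable def laplacian (p : ℝ) (l : ℕ) : Matrix (Fin (3 ^ l + 1)) (Fin (3 ^ l + 1)) ℂ :=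
  fun x y => (if x = y then 1 else 0) - (truncProb p l x y : ℂ)

/-- The level-`l` truncated self-similar almost Mathieu operator `H_{p,β,α,θ}^{(l)}`, as a matrix in
the canonical basis: `(H f)(x) = β cos(2παx + θ) f x - ∑ y, p(x, y) f y`. -/
noncomputable def almostMathieu (p β α θ : ℝ) (l : ℕ) :
    Matrix (Fin (3 ^ l + 1)) (Fin (3 ^ l + 1)) ℂ :=
  fun x y => (if x = y then ((β * Real.cos (2 * Real.pi * α * ((x : ℕ) : ℝ) + θ) : ℝ) : ℂ) else 0)
    - (truncProb p l x y : ℂ)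

/-!
The proof is spectral decimation by transfer matrices. The operators are tridiagonal with nonzero
off-diagonal entries, so an eigenvector is determined by its value at `0`, and `z` lies in the
spectrum at level `l` iff the half-line solution `reflSol` meets the boundary condition at `3 ^ l`
(`mem_spectrum_potentialOp`).

Cut the half-line into blocks of length `q = 3 ^ n`. The step probabilities inside a block are the
same for all blocks and are exchanged by the reflection of the block, while those at `j q` equal
those at `j`; the potential `β cos (2π k x / q)` has the same symmetries. Let `c`, `s` be the
polynomials in `z` given by the values at `q` of the solutions with initial values `(1, 0)` and
`(0, 1)`. By the reflection symmetry every solution `f` satisfies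
`s f(j q ± 1) = f((j ± 1) q) - c f(j q)`. Inserted into the equation at `j q`, this shows that
`j ↦ f(j q)` solves the eigenvalue equation of the Laplacian at the parameter
`R = 1 - (V 0 - z) s - c` (`decimation`), and when `s(z) ≠ 0` the boundary conditions correspond as
well (`mem_spectrum_iff_of_sinSol_ne_zero`). Since the spectrum `{0, 2}` of the level-`0` Laplacian
is contained in that of every level, the theorem follows at such `z`.

The zeros of `s` are the Dirichlet eigenvalues of a block. There `c ^ 2 = 1`, hence `R(z) ∈ {0, 2}`,
and it remains to see that membership in the spectrum at level `l` does not depend on `l`.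
The Wronskian identity `wronskian_block` shows that the defect in the boundary condition at
`3 ^ l` is, up to sign, a positive multiple of its value for `l = n` (`exists_defect_eq`):
passing to the next block only adds positive multiples of that value.
-/

open Polynomial Finset

/-! ### Transition probabilities -/

/-- The probability of a step to the right from `x`. -/
noncomputable def stepRight (p : ℝ) (x : ℕ) : ℝ := transProb p x (x + 1)

/-- The probability of a step to the left from `x`; meaningful for `1 ≤ x` only. -/
noncomputable def stepLeft (p : ℝ) (x : ℕ) : ℝ := transProb p x (x - 1)

/-- The lowest nonzero ternary digit of a positive integer. -/
def lowDigit (x : ℕ) : ℕ := x / 3 ^ padicValNat 3 x % 3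

theorem lowDigit_pow_mul (m : ℕ) {u : ℕ} (hu : ¬ 3 ∣ u) : lowDigit (3 ^ m * u) = u % 3 := by
  have h0 : u ≠ 0 := by rintro rfl; simp at hu
  have : padicValNat 3 (3 ^ m * u) = m := by
    rw [padicValNat.mul (by positivity) h0, padicValNat.prime_pow,
      padicValNat.eq_zero_of_not_dvd hu, add_zero]
  rw [lowDigit, this, Nat.mul_div_cancel_left _ (by positivity)]

theorem exists_eq_pow_mul {x : ℕ} (hx : 0 < x) : ∃ m u, ¬ 3 ∣ u ∧ x = 3 ^ m * u := by
  obtain ⟨m, u, hu, h⟩ := Nat.exists_eq_pow_mul_and_not_dvd hx.ne' 3 (by norm_num)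
  exact ⟨m, u, hu, h⟩

/-- Inside a block of length `3 ^ n` the exponent of `3` is less than `n`. -/
theorem exists_eq_pow_mul_of_lt {n r : ℕ} (hr : 0 < r) (hrn : r < 3 ^ n) :
    ∃ m u s, ¬ 3 ∣ u ∧ r = 3 ^ m * u ∧ 3 ^ n = 3 ^ m * (3 * s) := by
  obtain ⟨m, u, hu, h⟩ := exists_eq_pow_mul hr
  have hu0 : 0 < u := Nat.pos_of_ne_zero (by rintro rfl; simp at hu)
  have hm : m < n := by
    have : 3 ^ m < 3 ^ n := lt_of_le_of_lt (by rw [h]; exact Nat.le_mul_of_pos_right _ hu0) hrn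
    exact (Nat.pow_lt_pow_iff_right (by norm_num)).1 this
  obtain ⟨d, rfl⟩ := Nat.exists_eq_add_of_lt hm
  exact ⟨m, u, 3 ^ d, hu, h, by ring⟩

theorem lowDigit_pow_mul_self (n : ℕ) {j : ℕ} (hj : 0 < j) : lowDigit (j * 3 ^ n) = lowDigit j := by
  obtain ⟨m, u, hu, rfl⟩ := exists_eq_pow_mul hj
  rw [lowDigit_pow_mul m hu, show 3 ^ m * u * 3 ^ n = 3 ^ (m + n) * u by ring,
    lowDigit_pow_mul _ hu]

theorem lowDigit_add_block {n r : ℕ} (j : ℕ) (hr : 0 < r) (hrn : r < 3 ^ n) :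
    lowDigit (j * 3 ^ n + r) = lowDigit r := by
  obtain ⟨m, u, s, hu, rfl, h⟩ := exists_eq_pow_mul_of_lt hr hrn
  rw [h, show j * (3 ^ m * (3 * s)) + 3 ^ m * u = 3 ^ m * (3 * (j * s) + u) by ring,
    lowDigit_pow_mul _ hu, lowDigit_pow_mul _ (by omega)]
  omega

theorem lowDigit_block_sub {n r : ℕ} (hr : 0 < r) (hrn : r < 3 ^ n) :
    lowDigit (3 ^ n - r) = 1 ↔ lowDigit r ≠ 1 := by
  obtain ⟨m, u, s, hu, rfl, h⟩ := exists_eq_pow_mul_of_lt hr hrn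
  have hlt : u < 3 * s := by
    rw [h] at hrn
    exact lt_of_mul_lt_mul_left hrn (Nat.zero_le _)
  rw [h, ← Nat.mul_sub, lowDigit_pow_mul _ hu, lowDigit_pow_mul _ (by omega)]
  omega

theorem stepRight_eq (p : ℝ) {x : ℕ} (hx : 0 < x) :
    stepRight p x = if lowDigit x = 1 then p else 1 - p := by
  have h : x + 1 + 1 ≠ x := by omega
  simp only [stepRight, transProb, lowDigit, if_neg hx.ne', if_neg h, if_true]
  rfl

theorem stepLeft_eq (p : ℝ) {x : ℕ} (hx : 0 < x) :
    stepLeft p x = if lowDigit x = 1 then 1 - p else p := by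
  have : x - 1 + 1 = x := by omega
  simp only [stepLeft, transProb, lowDigit, if_neg hx.ne', this, if_true]
  rfl

theorem stepLeft_add_stepRight (p : ℝ) {x : ℕ} (hx : 0 < x) :
    stepLeft p x + stepRight p x = 1 := by
  rw [stepLeft_eq p hx, stepRight_eq p hx]; split_ifs <;> ring

theorem stepRight_pos {p : ℝ} (hp : p ∈ Set.Ioo (0 : ℝ) 1) {x : ℕ} (hx : 0 < x) :
    0 < stepRight p x := by
  rw [stepRight_eq p hx]; split_ifs <;> linarith [hp.1, hp.2]

theorem stepLeft_pos {p : ℝ} (hp : p ∈ Set.Ioo (0 : ℝ) 1) {x : ℕ} (hx : 0 < x) :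
    0 < stepLeft p x := by
  rw [stepLeft_eq p hx]; split_ifs <;> linarith [hp.1, hp.2]

theorem stepRight_block_sub (p : ℝ) {n r : ℕ} (hr : 0 < r) (hrn : r < 3 ^ n) :
    stepRight p (3 ^ n - r) = stepLeft p r := by
  rw [stepRight_eq p (by omega), stepLeft_eq p hr]
  have := lowDigit_block_sub hr hrn
  split_ifs <;> tauto

theorem stepLeft_block_sub (p : ℝ) {n r : ℕ} (hr : 0 < r) (hrn : r < 3 ^ n) :
    stepLeft p (3 ^ n - r) = stepRight p r := by
  have h := stepRight_block_sub p (n := n) (r := 3 ^ n - r) (by omega) (by omega)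
  rw [← h, Nat.sub_sub_self hrn.le]

theorem truncProb_of_lt (p : ℝ) {l x : ℕ} (hx : 0 < x) (hxl : x < 3 ^ l) (y : ℕ) :
    truncProb p l x y =
      (if y = x - 1 then stepLeft p x else 0) + (if y = x + 1 then stepRight p x else 0) := by
  rw [stepLeft_eq p hx, stepRight_eq p hx]
  unfold truncProb transProb lowDigit
  rw [if_neg hxl.ne, if_neg hx.ne']
  split_ifs <;> first | omega | simp

/-! ### Three-term recurrences and the spectrum -/

/-- `f` solves the eigenvalue equation `V f - P f = z f` at the point `x`, where `1 ≤ x` is not a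
reflecting point of the truncation. -/
def EigenAt (p : ℝ) (V : ℕ → ℝ) (z : ℂ) (f : ℕ → ℂ) (x : ℕ) : Prop :=
  ((V x : ℂ) - z) * f x = stepLeft p x * f (x - 1) + stepRight p x * f (x + 1)

theorem eigenAt_eq_of_eq {p : ℝ} (hp : p ∈ Set.Ioo (0 : ℝ) 1) {V : ℕ → ℝ} {z : ℂ} {f g : ℕ → ℂ}
    {N : ℕ} (hf : ∀ x, 0 < x → x < N → EigenAt p V z f x)
    (hg : ∀ x, 0 < x → x < N → EigenAt p V z g x) (h0 : f 0 = g 0) (h1 : f 1 = g 1) :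
    ∀ x ≤ N, f x = g x := by
  have key : ∀ x, (x ≤ N → f x = g x) ∧ (x + 1 ≤ N → f (x + 1) = g (x + 1)) := by
    intro x
    induction x with
    | zero => exact ⟨fun _ => h0, fun _ => h1⟩
    | succ x ih =>
      refine ⟨ih.2, fun hx => ?_⟩
      have hb : (stepRight p (x + 1) : ℂ) ≠ 0 := by
        exact_mod_cast (stepRight_pos hp x.succ_pos).ne'
      have e1 := hf (x + 1) x.succ_pos (by omega)
      have e2 := hg (x + 1) x.succ_pos (by omega)
      simp only [EigenAt, Nat.add_sub_cancel] at e1 e2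
      rw [ih.1 (by omega), ih.2 (by omega), e2] at e1
      exact (mul_left_cancel₀ hb (add_left_cancel e1)).symm
  exact fun x => (key x).1

/-- The solution of the eigenvalue equation on the half-line with initial values `u`, `v`, as a
polynomial in the spectral parameter. -/
noncomputable def solPoly (p : ℝ) (V : ℕ → ℝ) (u v : ℝ[X]) : ℕ → ℝ[X]
  | 0 => u
  | 1 => v
  | x + 2 => C (stepRight p (x + 1))⁻¹ *
      ((C (V (x + 1)) - X) * solPoly p V u v (x + 1) - C (stepLeft p (x + 1)) * solPoly p V u v x)

theorem eigenAt_solPoly {p : ℝ} (hp : p ∈ Set.Ioo (0 : ℝ) 1) (V : ℕ → ℝ) (u v : ℝ[X]) (z : ℂ)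
    {x : ℕ} (hx : 0 < x) : EigenAt p V z (fun x => aeval z (solPoly p V u v x)) x := by
  obtain ⟨x, rfl⟩ := Nat.exists_eq_succ_of_ne_zero hx.ne'
  have hb : (stepRight p (x + 1) : ℂ) ≠ 0 := by
    exact_mod_cast (stepRight_pos hp x.succ_pos).ne'
  simp only [EigenAt, Nat.succ_eq_add_one, Nat.add_sub_cancel, solPoly]
  simp only [map_mul, map_sub, aeval_C, aeval_X, Complex.coe_algebraMap, Complex.ofReal_inv]
  field_simp
  ring

/-- The solution on the half-line that meets the reflecting condition at `0`. -/
noncomputable def reflSol (p : ℝ) (V : ℕ → ℝ) (z : ℂ) (x : ℕ) : ℂ :=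
  aeval z (solPoly p V 1 (C (V 0) - X) x)

theorem reflSol_zero (p : ℝ) (V : ℕ → ℝ) (z : ℂ) : reflSol p V z 0 = 1 := by
  simp [reflSol, solPoly]

theorem reflSol_one (p : ℝ) (V : ℕ → ℝ) (z : ℂ) : reflSol p V z 1 = V 0 - z := by
  simp [reflSol, solPoly]

theorem eigenAt_reflSol {p : ℝ} (hp : p ∈ Set.Ioo (0 : ℝ) 1) (V : ℕ → ℝ) (z : ℂ) {x : ℕ}
    (hx : 0 < x) : EigenAt p V z (reflSol p V z) x :=
  eigenAt_solPoly hp V _ _ z hx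

/-- The level-`l` operator `V - P` with an arbitrary potential `V`. -/
noncomputable def potentialOp (p : ℝ) (V : ℕ → ℝ) (l : ℕ) :
    Matrix (Fin (3 ^ l + 1)) (Fin (3 ^ l + 1)) ℂ :=
  fun x y => (if x = y then (V x : ℂ) else 0) - (truncProb p l x y : ℂ)

theorem potentialOp_mulVec (p : ℝ) (V : ℕ → ℝ) (l : ℕ) (g : ℕ → ℂ) (x : Fin (3 ^ l + 1)) :
    (potentialOp p V l).mulVec (fun y => g y) x =
      V x * g x - ∑ y ∈ range (3 ^ l + 1), (truncProb p l x y : ℂ) * g y := by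
  rw [← Fin.sum_univ_eq_sum_range (fun y => (truncProb p l x y : ℂ) * g y)]
  simp [Matrix.mulVec, dotProduct, potentialOp, sub_mul, Finset.sum_sub_distrib, ite_mul]

theorem eigenvector_iff (p : ℝ) (V : ℕ → ℝ) (l : ℕ) (z : ℂ) (g : ℕ → ℂ) :
    (potentialOp p V l).mulVec (fun y => g y) = z • (fun y : Fin (3 ^ l + 1) => g y) ↔
      ((V 0 : ℂ) - z) * g 0 = g 1 ∧ (∀ x, 0 < x → x < 3 ^ l → EigenAt p V z g x) ∧
        ((V (3 ^ l) : ℂ) - z) * g (3 ^ l) = g (3 ^ l - 1) := by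
  have hN : 0 < 3 ^ l := by positivity
  have e0 : ∑ y ∈ range (3 ^ l + 1), (truncProb p l 0 y : ℂ) * g y = g 1 := by
    rw [Finset.sum_eq_single 1]
    · simp [truncProb, transProb, hN.ne]
    · intro y _ hy
      simp [truncProb, transProb, hN.ne, hy]
    · intro h; simp at h
  have eN : ∑ y ∈ range (3 ^ l + 1), (truncProb p l (3 ^ l) y : ℂ) * g y = g (3 ^ l - 1) := by
    rw [Finset.sum_eq_single (3 ^ l - 1)]
    · simp [truncProb, Nat.sub_add_cancel hN]
    · intro y _ hy
      have : y + 1 ≠ 3 ^ l := by omega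
      simp [truncProb, this]
    · intro h
      exact absurd (mem_range.2 (by omega)) h
  have ex : ∀ x, 0 < x → x < 3 ^ l → ∑ y ∈ range (3 ^ l + 1), (truncProb p l x y : ℂ) * g y =
      stepLeft p x * g (x - 1) + stepRight p x * g (x + 1) := by
    intro x hx hxl
    have h1 : x - 1 < 3 ^ l + 1 := by omega
    have h2 : x < 3 ^ l := hxl
    simp only [truncProb_of_lt p hx hxl, Complex.ofReal_add, add_mul, sum_add_distrib,
      apply_ite Complex.ofReal, Complex.ofReal_zero, ite_mul, zero_mul, sum_ite_eq', mem_range,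
      if_pos h1, if_pos (Nat.succ_lt_succ h2)]
  constructor
  · intro h
    have hx : ∀ x, x < 3 ^ l + 1 →
        V x * g x - ∑ y ∈ range (3 ^ l + 1), (truncProb p l x y : ℂ) * g y = z * g x := by
      intro x hx
      have := congrFun h ⟨x, hx⟩
      rw [potentialOp_mulVec] at this
      simpa using this
    refine ⟨?_, fun x h0 hl => ?_, ?_⟩
    · have := hx 0 (by omega)
      rw [e0] at this
      linear_combination this
    · have := hx x (by omega)
      rw [ex x h0 hl] at this
      unfold EigenAt
      linear_combination this
    · have := hx (3 ^ l) (by omega)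
      rw [eN] at this
      linear_combination this
  · rintro ⟨h0, h1, h2⟩
    ext ⟨x, hx⟩
    rw [potentialOp_mulVec]
    simp only [Pi.smul_apply, smul_eq_mul]
    rcases Nat.eq_zero_or_pos x with rfl | hx0
    · rw [e0]; linear_combination h0
    · rcases (Nat.lt_succ_iff.1 hx).lt_or_eq with hl | rfl
      · rw [ex x hx0 hl]
        have := h1 x hx0 hl
        unfold EigenAt at this
        linear_combination this
      · rw [eN]; linear_combination h2

theorem mem_spectrum_iff_exists_mulVec {m : Type*} [Fintype m] [DecidableEq m]
    (M : Matrix m m ℂ) (z : ℂ) : z ∈ spectrum ℂ M ↔ ∃ v ≠ 0, M.mulVec v = z • v := by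
  rw [spectrum.mem_iff, Matrix.isUnit_iff_isUnit_det, isUnit_iff_ne_zero, not_not,
    ← Matrix.exists_mulVec_eq_zero_iff]
  refine exists_congr fun v => and_congr_right fun _ => ?_
  rw [Matrix.sub_mulVec, sub_eq_zero, Algebra.algebraMap_eq_smul_one, Matrix.smul_mulVec,
    Matrix.one_mulVec, eq_comm]

/-- Shooting: since an eigenvector is determined by its value at `0`, `z` is an eigenvalue iff the
solution satisfying the condition at `0` also satisfies the one at `3 ^ l`. -/
theorem mem_spectrum_potentialOp {p : ℝ} (hp : p ∈ Set.Ioo (0 : ℝ) 1) (V : ℕ → ℝ) (l : ℕ) (z : ℂ) :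
    z ∈ spectrum ℂ (potentialOp p V l) ↔
      ((V (3 ^ l) : ℂ) - z) * reflSol p V z (3 ^ l) = reflSol p V z (3 ^ l - 1) := by
  rw [mem_spectrum_iff_exists_mulVec]
  constructor
  · rintro ⟨v, hv, h⟩
    set g : ℕ → ℂ := fun x => if h : x < 3 ^ l + 1 then v ⟨x, h⟩ else 0 with hg
    have hgv : v = fun y : Fin (3 ^ l + 1) => g y := by
      ext y
      simp only [hg, dif_pos y.2]
    rw [hgv, eigenvector_iff] at h
    obtain ⟨h0, h1, h2⟩ := h
    have hsol : ∀ x ≤ 3 ^ l, g x = g 0 * reflSol p V z x := by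
      refine eigenAt_eq_of_eq hp h1 (fun x hx _ => ?_) ?_ ?_
      · have := eigenAt_reflSol hp V z hx
        unfold EigenAt at this ⊢
        linear_combination g 0 * this
      · rw [reflSol_zero, mul_one]
      · rw [reflSol_one, ← h0]; ring
    have hg0 : g 0 ≠ 0 := by
      intro h
      apply hv
      rw [hgv]
      ext y
      simp [hsol y (Nat.lt_succ_iff.1 y.2), h]
    rw [hsol _ le_rfl, hsol _ (Nat.sub_le _ _)] at h2
    apply mul_left_cancel₀ hg0
    linear_combination h2
  · intro h
    refine ⟨fun y => reflSol p V z y, fun h => ?_, (eigenvector_iff p V l z _).2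
      ⟨by rw [reflSol_zero, reflSol_one, mul_one], fun x hx _ => eigenAt_reflSol hp V z hx, h⟩⟩
    have := congrFun h 0
    simp [reflSol_zero] at this

/-! ### The Laplacian -/

theorem laplacian_eq (p : ℝ) (l : ℕ) : laplacian p l = potentialOp p (fun _ => 1) l := by
  ext x y
  simp [laplacian, potentialOp]

theorem mem_spectrum_laplacian {p : ℝ} (hp : p ∈ Set.Ioo (0 : ℝ) 1) (l : ℕ) (w : ℂ) :
    w ∈ spectrum ℂ (laplacian p l) ↔
      (1 - w) * reflSol p (fun _ => 1) w (3 ^ l) = reflSol p (fun _ => 1) w (3 ^ l - 1) := by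
  rw [laplacian_eq, mem_spectrum_potentialOp hp]
  simp

theorem mem_spectrum_laplacian_zero {p : ℝ} (hp : p ∈ Set.Ioo (0 : ℝ) 1) (w : ℂ) :
    w ∈ spectrum ℂ (laplacian p 0) ↔ (1 - w) ^ 2 = 1 := by
  rw [mem_spectrum_laplacian hp]
  simp [reflSol_zero, reflSol_one, sq]

theorem spectrum_laplacian_zero_subset {p : ℝ} (hp : p ∈ Set.Ioo (0 : ℝ) 1) (l : ℕ) :
    spectrum ℂ (laplacian p 0) ⊆ spectrum ℂ (laplacian p l) := by
  intro w hw
  rw [mem_spectrum_laplacian_zero hp] at hw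
  have hN : 0 < 3 ^ l := by positivity
  have hsol : ∀ x ≤ 3 ^ l, reflSol p (fun _ => 1) w x = (1 - w) ^ x := by
    refine eigenAt_eq_of_eq hp (fun x hx _ => eigenAt_reflSol hp _ w hx) (fun x hx _ => ?_) ?_ ?_
    · obtain ⟨x, rfl⟩ := Nat.exists_eq_succ_of_ne_zero hx.ne'
      have hs : (stepLeft p (x + 1) : ℂ) + stepRight p (x + 1) = 1 := by
        exact_mod_cast stepLeft_add_stepRight p x.succ_pos
      simp only [EigenAt, Nat.succ_eq_add_one, Nat.add_sub_cancel, Complex.ofReal_one]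
      linear_combination (1 - w) ^ x * (1 - stepRight p (x + 1)) * hw - (1 - w) ^ x * hs
    · simp [reflSol_zero]
    · simp [reflSol_one]
  rw [mem_spectrum_laplacian hp, hsol _ le_rfl, hsol _ (Nat.sub_le _ _)]
  obtain ⟨m, hm⟩ := Nat.exists_eq_succ_of_ne_zero hN.ne'
  rw [hm, Nat.succ_eq_add_one, Nat.add_sub_cancel]
  linear_combination (1 - w) ^ m * hw

/-! ### Solutions on one block -/

/-- A potential of period `q` that is symmetric under reflection of the block `{0, …, q}`. -/
structure IsBlockSymm (V : ℕ → ℝ) (q : ℕ) : Prop where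
  periodic : ∀ j r, V (j * q + r) = V r
  reflect : ∀ r ≤ q, V (q - r) = V r

/-- The solution with initial values `1, 0`. -/
noncomputable def cosSol (p : ℝ) (V : ℕ → ℝ) : ℕ → ℝ[X] := solPoly p V 1 0

/-- The solution with initial values `0, 1`. Its value at `q` is, up to a nonzero constant, the
characteristic polynomial of the operator on `{1, …, q - 1}` with Dirichlet conditions. -/
noncomputable def sinSol (p : ℝ) (V : ℕ → ℝ) : ℕ → ℝ[X] := solPoly p V 0 1

theorem eq_cosSol_add_sinSol {p : ℝ} (hp : p ∈ Set.Ioo (0 : ℝ) 1) {V : ℕ → ℝ} {z : ℂ}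
    {f : ℕ → ℂ} {N : ℕ} (hf : ∀ x, 0 < x → x < N → EigenAt p V z f x) :
    ∀ x ≤ N, f x = f 0 * aeval z (cosSol p V x) + f 1 * aeval z (sinSol p V x) := by
  refine eigenAt_eq_of_eq hp hf (fun x hx _ => ?_) ?_ ?_
  · have h1 := eigenAt_solPoly hp V 1 0 z hx
    have h2 := eigenAt_solPoly hp V 0 1 z hx
    simp only [EigenAt, cosSol, sinSol] at *
    linear_combination f 0 * h1 + f 1 * h2
  · simp [cosSol, sinSol, solPoly]
  · simp [cosSol, sinSol, solPoly]

theorem EigenAt.block {p : ℝ} {V : ℕ → ℝ} {n : ℕ} (hV : IsBlockSymm V (3 ^ n)) {z : ℂ}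
    {f : ℕ → ℂ} (hf : ∀ x, 0 < x → EigenAt p V z f x) (j : ℕ) :
    ∀ r, 0 < r → r < 3 ^ n → EigenAt p V z (fun r => f (j * 3 ^ n + r)) r := by
  intro r hr hrn
  have := hf (j * 3 ^ n + r) (by omega)
  have hd := lowDigit_add_block j hr hrn
  rw [EigenAt, stepLeft_eq p (by omega), stepRight_eq p (by omega), hd, ← stepLeft_eq p hr,
    ← stepRight_eq p hr, hV.periodic, Nat.add_sub_assoc hr, add_assoc] at this
  exact this

theorem EigenAt.reflect {p : ℝ} {V : ℕ → ℝ} {n : ℕ} (hV : IsBlockSymm V (3 ^ n)) {z : ℂ}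
    {f : ℕ → ℂ} (hf : ∀ x, 0 < x → x < 3 ^ n → EigenAt p V z f x) :
    ∀ r, 0 < r → r < 3 ^ n → EigenAt p V z (fun r => f (3 ^ n - r)) r := by
  intro r hr hrn
  have := hf (3 ^ n - r) (by omega) (by omega)
  rw [EigenAt, stepLeft_block_sub p hr hrn, stepRight_block_sub p hr hrn, hV.reflect r hrn.le,
    Nat.sub_sub, show 3 ^ n - r + 1 = 3 ^ n - (r - 1) by omega] at this
  rw [EigenAt]
  linear_combination this

/-- Both end values of a block, each in terms of the data at the other end. -/
theorem block_ends {p : ℝ} (hp : p ∈ Set.Ioo (0 : ℝ) 1) {V : ℕ → ℝ} {n : ℕ}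
    (hV : IsBlockSymm V (3 ^ n)) {z : ℂ} {f : ℕ → ℂ}
    (hf : ∀ x, 0 < x → x < 3 ^ n → EigenAt p V z f x) :
    f (3 ^ n) = f 0 * aeval z (cosSol p V (3 ^ n)) + f 1 * aeval z (sinSol p V (3 ^ n)) ∧
    f 0 = f (3 ^ n) * aeval z (cosSol p V (3 ^ n)) +
      f (3 ^ n - 1) * aeval z (sinSol p V (3 ^ n)) := by
  refine ⟨eq_cosSol_add_sinSol hp hf _ le_rfl, ?_⟩
  simpa using eq_cosSol_add_sinSol hp (EigenAt.reflect hV hf) _ le_rfl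

/-- The Wronskian of `cosSol` and `sinSol` has the same value at both ends of a block, because the
reflection of the block exchanges left and right step probabilities. -/
theorem wronskian_block {p : ℝ} (hp : p ∈ Set.Ioo (0 : ℝ) 1) (V : ℕ → ℝ) (n : ℕ) (z : ℂ) :
    aeval z (cosSol p V (3 ^ n - 1)) * aeval z (sinSol p V (3 ^ n)) -
      aeval z (cosSol p V (3 ^ n)) * aeval z (sinSol p V (3 ^ n - 1)) = 1 := by
  have key : ∀ x, (∏ i ∈ range x, (stepRight p (i + 1) : ℂ)) *
      (aeval z (cosSol p V x) * aeval z (sinSol p V (x + 1)) -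
        aeval z (cosSol p V (x + 1)) * aeval z (sinSol p V x)) =
      ∏ i ∈ range x, (stepLeft p (i + 1) : ℂ) := by
    intro x
    induction x with
    | zero => simp [cosSol, sinSol, solPoly]
    | succ x ih =>
      have h1 := eigenAt_solPoly hp V 1 0 z x.succ_pos
      have h2 := eigenAt_solPoly hp V 0 1 z x.succ_pos
      simp only [EigenAt, Nat.add_sub_cancel, Nat.succ_eq_add_one] at h1 h2
      rw [prod_range_succ, prod_range_succ, ← ih]
      simp only [cosSol, sinSol]
      linear_combination (∏ i ∈ range x, (stepRight p (i + 1) : ℂ)) *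
        (aeval z (solPoly p V 0 1 (x + 1)) * h1 - aeval z (solPoly p V 1 0 (x + 1)) * h2)
  have hN : 0 < 3 ^ n := by positivity
  have hprod : ∏ i ∈ range (3 ^ n - 1), (stepLeft p (i + 1) : ℂ) =
      ∏ i ∈ range (3 ^ n - 1), (stepRight p (i + 1) : ℂ) := by
    rw [← prod_range_reflect]
    refine prod_congr rfl fun i hi => ?_
    have hi' := mem_range.1 hi
    rw [show 3 ^ n - 1 - 1 - i + 1 = 3 ^ n - (i + 1) by omega,
      stepLeft_block_sub p (by omega) (by omega)]
  have hne : ∏ i ∈ range (3 ^ n - 1), (stepRight p (i + 1) : ℂ) ≠ 0 :=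
    prod_ne_zero_iff.2 fun i _ => by exact_mod_cast (stepRight_pos hp i.succ_pos).ne'
  have h := key (3 ^ n - 1)
  rw [hprod, Nat.sub_add_cancel hN] at h
  exact mul_left_cancel₀ hne (by rw [h, mul_one])

/-! ### The decimation polynomial -/

/-- The polynomial of spectral decimation. Eliminating the interior points of all blocks of
length `q` turns `V - P - z` into a multiple of `Δ - decimation z` on the multiples of `q`. -/
noncomputable def decimation (p : ℝ) (V : ℕ → ℝ) (q : ℕ) : ℝ[X] :=
  1 - (C (V 0) - X) * sinSol p V q - cosSol p V q

theorem aeval_decimation (p : ℝ) (V : ℕ → ℝ) (q : ℕ) (z : ℂ) :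
    aeval z (decimation p V q) =
      1 - ((V 0 : ℂ) - z) * aeval z (sinSol p V q) - aeval z (cosSol p V q) := by
  simp [decimation]

theorem natDegree_C_sub_X (c : ℝ) : (C c - X : ℝ[X]).natDegree = 1 := by
  rw [← neg_sub, natDegree_neg, natDegree_X_sub_C]

theorem C_sub_X_ne_zero (c : ℝ) : (C c - X : ℝ[X]) ≠ 0 := fun h => by
  simpa [h] using natDegree_C_sub_X c

theorem natDegree_sinSol {p : ℝ} (hp : p ∈ Set.Ioo (0 : ℝ) 1) (V : ℕ → ℝ) (x : ℕ) :
    (sinSol p V x).natDegree ≤ x ∧ sinSol p V (x + 1) ≠ 0 ∧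
      (sinSol p V (x + 1)).natDegree = x := by
  induction x with
  | zero => simp [sinSol, solPoly]
  | succ x ih =>
    obtain ⟨h1, h2, h3⟩ := ih
    have hb : (stepRight p (x + 1))⁻¹ ≠ 0 := inv_ne_zero (stepRight_pos hp x.succ_pos).ne'
    have hdeg : (sinSol p V (x + 1 + 1)).natDegree = x + 1 := by
      have hmain : ((C (V (x + 1)) - X) * sinSol p V (x + 1)).natDegree = x + 1 := by
        rw [natDegree_mul (C_sub_X_ne_zero _) h2, natDegree_C_sub_X, h3, add_comm]
      change (C (stepRight p (x + 1))⁻¹ * ((C (V (x + 1)) - X) * sinSol p V (x + 1) -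
        C (stepLeft p (x + 1)) * sinSol p V x)).natDegree = x + 1
      rw [natDegree_C_mul hb, natDegree_sub_eq_left_of_natDegree_lt, hmain]
      rw [hmain]
      exact lt_of_le_of_lt ((natDegree_C_mul_le _ _).trans h1) x.lt_succ_self
    refine ⟨by omega, fun h => ?_, hdeg⟩
    rw [h] at hdeg
    simp at hdeg

theorem natDegree_cosSol_le (p : ℝ) (V : ℕ → ℝ) (x : ℕ) :
    (cosSol p V x).natDegree ≤ x ∧ (cosSol p V (x + 1)).natDegree ≤ x := by
  induction x with
  | zero => simp [cosSol, solPoly]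
  | succ x ih =>
    refine ⟨by omega, ?_⟩
    change (C (stepRight p (x + 1))⁻¹ * ((C (V (x + 1)) - X) * cosSol p V (x + 1) -
      C (stepLeft p (x + 1)) * cosSol p V x)).natDegree ≤ x + 1
    refine (natDegree_C_mul_le _ _).trans ((natDegree_sub_le _ _).trans (max_le ?_ ?_))
    · refine natDegree_mul_le.trans ?_
      rw [natDegree_C_sub_X]
      omega
    · exact (natDegree_C_mul_le _ _).trans (by omega)

theorem natDegree_decimation {p : ℝ} (hp : p ∈ Set.Ioo (0 : ℝ) 1) (V : ℕ → ℝ) {q : ℕ}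
    (hq : 0 < q) : (decimation p V q).natDegree = q := by
  obtain ⟨x, rfl⟩ := Nat.exists_eq_succ_of_ne_zero hq.ne'
  obtain ⟨-, h2, h3⟩ := natDegree_sinSol hp V x
  have hmain : ((C (V 0) - X) * sinSol p V (x + 1)).natDegree = x + 1 := by
    rw [natDegree_mul (C_sub_X_ne_zero _) h2, natDegree_C_sub_X, h3, add_comm]
  have hc := (natDegree_cosSol_le p V x).2
  have h : (1 - (C (V 0) - X) * sinSol p V (x + 1)).natDegree = x + 1 := by
    rw [natDegree_sub_eq_right_of_natDegree_lt, hmain]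
    rw [hmain, natDegree_one]
    exact x.succ_pos
  rw [decimation, Nat.succ_eq_add_one, natDegree_sub_eq_left_of_natDegree_lt, h]
  rw [h]
  omega

/-! ### Spectral decimation -/

section Decimation

variable {p : ℝ} {V : ℕ → ℝ} {n : ℕ} {z : ℂ}

theorem reflSol_block_ends (hp : p ∈ Set.Ioo (0 : ℝ) 1) (hV : IsBlockSymm V (3 ^ n)) (j : ℕ) :
    reflSol p V z ((j + 1) * 3 ^ n) =
      reflSol p V z (j * 3 ^ n) * aeval z (cosSol p V (3 ^ n)) +
        reflSol p V z (j * 3 ^ n + 1) * aeval z (sinSol p V (3 ^ n)) ∧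
    reflSol p V z (j * 3 ^ n) =
      reflSol p V z ((j + 1) * 3 ^ n) * aeval z (cosSol p V (3 ^ n)) +
        reflSol p V z ((j + 1) * 3 ^ n - 1) * aeval z (sinSol p V (3 ^ n)) := by
  have hN : 0 < 3 ^ n := by positivity
  have h := block_ends hp hV
    (EigenAt.block hV (fun x hx => eigenAt_reflSol hp V z hx) j)
  simpa only [add_zero, ← Nat.add_sub_assoc (Nat.succ_le_of_lt hN), ← Nat.succ_mul] using h

/-- The eigenvalue equation at a multiple of the block length. -/
theorem eigenAt_reflSol_mul (hp : p ∈ Set.Ioo (0 : ℝ) 1) (hV : IsBlockSymm V (3 ^ n)) {j : ℕ}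
    (hj : 0 < j) :
    ((V 0 : ℂ) - z) * reflSol p V z (j * 3 ^ n) =
      stepLeft p j * reflSol p V z (j * 3 ^ n - 1) +
        stepRight p j * reflSol p V z (j * 3 ^ n + 1) := by
  have hpos : 0 < j * 3 ^ n := by positivity
  have h := eigenAt_reflSol hp V z hpos
  have hV0 : V (j * 3 ^ n) = V 0 := by simpa using hV.periodic j 0
  rwa [EigenAt, stepLeft_eq p hpos, stepRight_eq p hpos, lowDigit_pow_mul_self n hj,
    ← stepLeft_eq p hj, ← stepRight_eq p hj, hV0] at h

/-- Restriction to the multiples of the block length gives the solution for the Laplacian at the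
spectral parameter `decimation z`. -/
theorem reflSol_mul_eq (hp : p ∈ Set.Ioo (0 : ℝ) 1) (hV : IsBlockSymm V (3 ^ n))
    (j : ℕ) :
    reflSol p V z (j * 3 ^ n) =
      reflSol p (fun _ => 1) (aeval z (decimation p V (3 ^ n))) j := by
  refine eigenAt_eq_of_eq (N := j) hp (V := fun _ => 1)
    (z := aeval z (decimation p V (3 ^ n))) (f := fun j => reflSol p V z (j * 3 ^ n))
    (fun x hx _ => ?_) (fun x hx _ => eigenAt_reflSol hp _ _ hx) ?_ ?_ j le_rfl
  · obtain ⟨x, rfl⟩ := Nat.exists_eq_succ_of_ne_zero hx.ne'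
    have hs : (stepLeft p (x + 1) : ℂ) + stepRight p (x + 1) = 1 := by
      exact_mod_cast stepLeft_add_stepRight p x.succ_pos
    have h1 := (reflSol_block_ends (z := z) hp hV x).2
    have h2 := (reflSol_block_ends (z := z) hp hV (x + 1)).1
    have h3 := eigenAt_reflSol_mul (z := z) hp hV x.succ_pos
    simp only [EigenAt, Nat.succ_eq_add_one, Nat.add_sub_cancel, Complex.ofReal_one,
      aeval_decimation] at h3 ⊢
    linear_combination aeval z (sinSol p V (3 ^ n)) * h3 - stepLeft p (x + 1) * h1
      - stepRight p (x + 1) * h2 - reflSol p V z ((x + 1) * 3 ^ n) *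
        aeval z (cosSol p V (3 ^ n)) * hs
  · simp [reflSol_zero]
  · have h := (reflSol_block_ends (z := z) hp hV 0).1
    simp only [Nat.zero_mul, zero_add, reflSol_zero, reflSol_one, aeval_decimation] at h ⊢
    rw [h, Complex.ofReal_one]
    ring

theorem mem_spectrum_iff_of_sinSol_ne_zero (hp : p ∈ Set.Ioo (0 : ℝ) 1)
    (hV : IsBlockSymm V (3 ^ n)) (hS : aeval z (sinSol p V (3 ^ n)) ≠ 0) (m : ℕ) :
    z ∈ spectrum ℂ (potentialOp p V (m + n)) ↔
      aeval z (decimation p V (3 ^ n)) ∈ spectrum ℂ (laplacian p m) := by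
  rw [mem_spectrum_potentialOp hp, mem_spectrum_laplacian hp, pow_add,
    show V (3 ^ m * 3 ^ n) = V 0 by simpa using hV.periodic (3 ^ m) 0,
    ← reflSol_mul_eq hp hV, ← reflSol_mul_eq hp hV]
  have hN : 0 < 3 ^ m := by positivity
  obtain ⟨N, hN⟩ := Nat.exists_eq_succ_of_ne_zero hN.ne'
  rw [hN, Nat.succ_eq_add_one, Nat.add_sub_cancel, aeval_decimation]
  have h := (reflSol_block_ends (z := z) hp hV N).2
  constructor
  · intro h'
    linear_combination aeval z (sinSol p V (3 ^ n)) * h' - h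
  · intro h'
    apply mul_left_cancel₀ hS
    linear_combination h' + h

theorem cosSol_sq_of_sinSol_eq_zero (hp : p ∈ Set.Ioo (0 : ℝ) 1)
    (hV : IsBlockSymm V (3 ^ n)) (hS : aeval z (sinSol p V (3 ^ n)) = 0) :
    aeval z (cosSol p V (3 ^ n)) ^ 2 = 1 := by
  obtain ⟨h1, h2⟩ := reflSol_block_ends (z := z) hp hV 0
  rw [h1, hS, Nat.zero_mul, reflSol_zero] at h2
  linear_combination -h2

theorem reflSol_mul_of_sinSol_eq_zero (hp : p ∈ Set.Ioo (0 : ℝ) 1)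
    (hV : IsBlockSymm V (3 ^ n)) (hS : aeval z (sinSol p V (3 ^ n)) = 0) (j : ℕ) :
    reflSol p V z (j * 3 ^ n) = aeval z (cosSol p V (3 ^ n)) ^ j := by
  induction j with
  | zero => simp [reflSol_zero]
  | succ j ih => rw [(reflSol_block_ends hp hV j).1, hS, ih, pow_succ]; ring

/-- At a Dirichlet eigenvalue of a block, the defect in the eigenvalue equation at the right end of
the level-`l` graph is a positive multiple of a quantity that does not depend on `l`. -/
theorem exists_defect_eq (hp : p ∈ Set.Ioo (0 : ℝ) 1)
    (hV : IsBlockSymm V (3 ^ n)) (hS : aeval z (sinSol p V (3 ^ n)) = 0) (j : ℕ) :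
    ∃ t : ℝ, 0 < t ∧
      aeval z (cosSol p V (3 ^ n)) ^ (j + 1) * reflSol p V z ((j + 1) * 3 ^ n - 1) - (V 0 - z) =
        t * (aeval z (cosSol p V (3 ^ n)) * aeval z (cosSol p V (3 ^ n - 1)) - 2 * (V 0 - z)) := by
  set δ := aeval z (cosSol p V (3 ^ n)) with hδ
  have hsq : δ ^ 2 = 1 := cosSol_sq_of_sinSol_eq_zero hp hV hS
  have hN : 0 < 3 ^ n := by positivity
  have hval : ∀ j, reflSol p V z (j * 3 ^ n) = δ ^ j := reflSol_mul_of_sinSol_eq_zero hp hV hS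
  have hε : δ * aeval z (sinSol p V (3 ^ n - 1)) = -1 := by
    have := wronskian_block hp V n z
    rw [hS] at this
    linear_combination -this
  have hend : ∀ j, reflSol p V z ((j + 1) * 3 ^ n - 1) =
      δ ^ j * aeval z (cosSol p V (3 ^ n - 1)) +
        reflSol p V z (j * 3 ^ n + 1) * aeval z (sinSol p V (3 ^ n - 1)) := by
    intro j
    have h := eq_cosSol_add_sinSol hp
      (EigenAt.block hV (fun x hx => eigenAt_reflSol hp V z hx) j) (3 ^ n - 1) (Nat.sub_le _ _)
    simp only [add_zero, ← Nat.add_sub_assoc (Nat.succ_le_of_lt hN), ← Nat.succ_mul] at h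
    rw [hval] at h
    exact h
  have hpow : ∀ j, δ ^ j * δ ^ j = 1 := fun j => by rw [← mul_pow, ← sq, hsq, one_pow]
  induction j with
  | zero =>
    refine ⟨1, one_pos, ?_⟩
    have h := hend 0
    simp only [Nat.zero_mul, zero_add, reflSol_one, pow_zero, pow_one] at h ⊢
    rw [h, Complex.ofReal_one]
    linear_combination (V 0 - z) * hε
  | succ j ih =>
    obtain ⟨t, ht, h⟩ := ih
    have hb := stepRight_pos hp j.succ_pos
    have ha := stepLeft_pos hp j.succ_pos
    refine ⟨1 + stepLeft p (j + 1) / stepRight p (j + 1) * t, by positivity, ?_⟩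
    have hb' : (stepRight p (j + 1) : ℂ) ≠ 0 := by exact_mod_cast hb.ne'
    have hs : (stepLeft p (j + 1) : ℂ) + stepRight p (j + 1) = 1 := by
      exact_mod_cast stepLeft_add_stepRight p j.succ_pos
    have he := eigenAt_reflSol_mul (z := z) hp hV j.succ_pos
    rw [Nat.succ_eq_add_one, hval] at he
    have hG : δ ^ (j + 1) * reflSol p V z ((j + 1) * 3 ^ n + 1) - (V 0 - z) =
        -(stepLeft p (j + 1) / stepRight p (j + 1) * t *
          (δ * aeval z (cosSol p V (3 ^ n - 1)) - 2 * (V 0 - z))) := by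
      field_simp
      linear_combination -δ ^ (j + 1) * he - stepLeft p (j + 1) * h
        + (V 0 - z) * hpow (j + 1) - (V 0 - z) * hs
    rw [hend (j + 1), pow_succ δ (j + 1)]
    push_cast
    linear_combination δ * aeval z (cosSol p V (3 ^ n - 1)) * hpow (j + 1) +
      δ ^ (j + 1) * reflSol p V z ((j + 1) * 3 ^ n + 1) * hε - hG

theorem mem_spectrum_iff_of_sinSol_eq_zero (hp : p ∈ Set.Ioo (0 : ℝ) 1)
    (hV : IsBlockSymm V (3 ^ n)) (hS : aeval z (sinSol p V (3 ^ n)) = 0) (m : ℕ) :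
    z ∈ spectrum ℂ (potentialOp p V (m + n)) ↔
      aeval z (cosSol p V (3 ^ n)) * aeval z (cosSol p V (3 ^ n - 1)) = 2 * (V 0 - z) := by
  have hN : 0 < 3 ^ m := by positivity
  obtain ⟨N, hN⟩ := Nat.exists_eq_succ_of_ne_zero hN.ne'
  obtain ⟨t, ht, h⟩ := exists_defect_eq hp hV hS N
  have hsq := cosSol_sq_of_sinSol_eq_zero hp hV hS
  have hpow : aeval z (cosSol p V (3 ^ n)) ^ (N + 1) * aeval z (cosSol p V (3 ^ n)) ^ (N + 1) = 1 :=
    by rw [← mul_pow, ← sq, hsq, one_pow]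
  rw [mem_spectrum_potentialOp hp, pow_add, hN, Nat.succ_eq_add_one,
    show V ((N + 1) * 3 ^ n) = V 0 by simpa using hV.periodic (N + 1) 0,
    reflSol_mul_of_sinSol_eq_zero hp hV hS]
  have ht' : (t : ℂ) ≠ 0 := by exact_mod_cast ht.ne'
  constructor
  · intro h'
    rw [← h'] at h
    have : (t : ℂ) * (aeval z (cosSol p V (3 ^ n)) * aeval z (cosSol p V (3 ^ n - 1)) -
        2 * (V 0 - z)) = t * 0 := by
      rw [← h]
      linear_combination (V 0 - z) * hpow
    exact sub_eq_zero.1 (mul_left_cancel₀ ht' this)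
  · intro h'
    rw [h', sub_self, mul_zero] at h
    linear_combination -aeval z (cosSol p V (3 ^ n)) ^ (N + 1) * h +
      reflSol p V z ((N + 1) * 3 ^ n - 1) * hpow

/-- Spectral decimation for a symmetric periodic potential. -/
theorem spectrum_potentialOp_eq (hp : p ∈ Set.Ioo (0 : ℝ) 1) (hV : IsBlockSymm V (3 ^ n))
    (m : ℕ) :
    spectrum ℂ (potentialOp p V (m + n)) =
      (fun z : ℂ => aeval z (decimation p V (3 ^ n))) ⁻¹'
          (spectrum ℂ (laplacian p m) \ spectrum ℂ (laplacian p 0)) ∪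
        spectrum ℂ (potentialOp p V n) := by
  ext z
  simp only [Set.mem_union, Set.mem_preimage, Set.mem_sdiff]
  rw [← Nat.zero_add n, show m + (0 + n) = m + n by omega]
  by_cases hS : aeval z (sinSol p V (3 ^ n)) = 0
  · -- here `decimation z` is `0` or `2`, so that only the second set matters
    have h0 : aeval z (decimation p V (3 ^ n)) ∈ spectrum ℂ (laplacian p 0) := by
      rw [mem_spectrum_laplacian_zero hp, aeval_decimation, hS]
      linear_combination cosSol_sq_of_sinSol_eq_zero hp hV hS
    rw [mem_spectrum_iff_of_sinSol_eq_zero hp hV hS, mem_spectrum_iff_of_sinSol_eq_zero hp hV hS]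
    simp [h0]
  · rw [mem_spectrum_iff_of_sinSol_ne_zero hp hV hS, mem_spectrum_iff_of_sinSol_ne_zero hp hV hS]
    simp only [Nat.zero_add]
    have := @spectrum_laplacian_zero_subset p hp m (aeval z (decimation p V (3 ^ n)))
    tauto

end Decimation

/-! ### The almost Mathieu potential -/

/-- The potential `β cos (2π (k / 3 ^ n) x)`. The phase `θ = 0` is kept as a summand, so that
`almostMathieu_eq` holds by definition. -/
noncomputable def mathieuPotential (β : ℝ) (n k x : ℕ) : ℝ :=
  β * Real.cos (2 * Real.pi * ((k : ℝ) / 3 ^ n) * (x : ℝ) + 0)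

theorem almostMathieu_eq (p β : ℝ) (n k l : ℕ) :
    almostMathieu p β ((k : ℝ) / 3 ^ n) 0 l = potentialOp p (mathieuPotential β n k) l := rfl

theorem isBlockSymm_mathieuPotential (β : ℝ) (n k : ℕ) :
    IsBlockSymm (mathieuPotential β n k) (3 ^ n) where
  periodic j r := by
    unfold mathieuPotential
    rw [← Real.cos_add_nat_mul_two_pi (2 * Real.pi * ((k : ℝ) / 3 ^ n) * (r : ℝ) + 0) (k * j)]
    congr 2
    push_cast
    field_simp
    ring
  reflect r hr := by
    unfold mathieuPotential
    rw [← Real.cos_nat_mul_two_pi_sub (2 * Real.pi * ((k : ℝ) / 3 ^ n) * (r : ℝ) + 0) k]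
    congr 2
    push_cast [hr]
    field_simp
    ring

theorem mathieuPotential_one_one (β : ℝ) {k : ℕ} (hk : k = 1 ∨ k = 2) :
    mathieuPotential β 1 k 1 = -β / 2 := by
  rcases hk with rfl | rfl
  · rw [mathieuPotential, show 2 * Real.pi * (((1 : ℕ) : ℝ) / 3 ^ 1) * ((1 : ℕ) : ℝ) + 0 =
      Real.pi - Real.pi / 3 by push_cast; ring, Real.cos_pi_sub, Real.cos_pi_div_three]
    ring
  · rw [mathieuPotential, show 2 * Real.pi * (((2 : ℕ) : ℝ) / 3 ^ 1) * ((1 : ℕ) : ℝ) + 0 =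
      Real.pi / 3 + Real.pi by push_cast; ring, Real.cos_add_pi, Real.cos_pi_div_three]
    ring

theorem aeval_decimation_mathieuPotential {p : ℝ} (hp : p ∈ Set.Ioo (0 : ℝ) 1) (β : ℝ) {k : ℕ}
    (hk : k = 1 ∨ k = 2) (z : ℂ) :
    aeval z (decimation p (mathieuPotential β 1 k) (3 ^ 1)) =
      (-(β : ℂ) + 2 * p - 2 * z) *
          ((β : ℂ) ^ 2 + 2 * β * p + β * z - 2 * p * z - 2 * p - 2 * z ^ 2 + 2) /
        (4 * p * (1 - p)) := by
  have hp0 : (p : ℂ) ≠ 0 := by exact_mod_cast hp.1.ne'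
  have hp1 : (1 - p : ℂ) ≠ 0 := by exact_mod_cast (sub_pos.2 hp.2).ne'
  have hV0 : mathieuPotential β 1 k 0 = β := by simp [mathieuPotential]
  have hV1 := mathieuPotential_one_one β hk
  have hV2 : mathieuPotential β 1 k 2 = -β / 2 := by
    rw [← hV1]
    exact (isBlockSymm_mathieuPotential β 1 k).reflect 1 (by norm_num)
  have hd1 : lowDigit 1 = 1 := by simpa using lowDigit_pow_mul 0 (u := 1) (by norm_num)
  have hd2 : lowDigit 2 = 2 := by simpa using lowDigit_pow_mul 0 (u := 2) (by norm_num)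
  have hr1 : stepRight p 1 = p := by simp [stepRight_eq, hd1]
  have hl1 : stepLeft p 1 = 1 - p := by simp [stepLeft_eq, hd1]
  have hr2 : stepRight p 2 = 1 - p := by simp [stepRight_eq, hd2]
  have hl2 : stepLeft p 2 = p := by simp [stepLeft_eq, hd2]
  rw [aeval_decimation, hV0]
  norm_num only [cosSol, sinSol, solPoly, pow_one, hV1, hV2, hr1, hl1, hr2, hl2]
  simp only [map_mul, map_sub, map_one, map_zero, aeval_C, aeval_X, Complex.coe_algebraMap]
  push_cast
  field_simp
  ring

theorem theorem3p1 (p β : ℝ) (hp : p ∈ Set.Ioo (0 : ℝ) 1) (n k : ℕ) (hn : 1 ≤ n)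
    (hk : k < 3 ^ n) :
    ∃ R : Polynomial ℝ, R.natDegree = 3 ^ n ∧
      (∀ l : ℕ, n ≤ l →
        spectrum ℂ (almostMathieu p β ((k : ℝ) / 3 ^ n) 0 l) =
          (fun z : ℂ => Polynomial.aeval z R) ⁻¹'
              (spectrum ℂ (laplacian p (l - n)) \ spectrum ℂ (laplacian p 0)) ∪
            spectrum ℂ (almostMathieu p β ((k : ℝ) / 3 ^ n) 0 n)) ∧
      (n = 1 → k = 1 ∨ k = 2 → ∀ z : ℂ,
        Polynomial.aeval z R =
          (-(β : ℂ) + 2 * p - 2 * z) *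
              ((β : ℂ) ^ 2 + 2 * β * p + β * z - 2 * p * z - 2 * p - 2 * z ^ 2 + 2) /
            (4 * p * (1 - p))) := by
  refine ⟨decimation p (mathieuPotential β n k) (3 ^ n),
    natDegree_decimation hp _ (by positivity), fun l hl => ?_, ?_⟩
  · obtain ⟨m, rfl⟩ := Nat.exists_eq_add_of_le' hl
    rw [Nat.add_sub_cancel, almostMathieu_eq, almostMathieu_eq]
    exact spectrum_potentialOp_eq hp (isBlockSymm_mathieuPotential β n k) m
  · rintro rfl hk' z
    exact aeval_decimation_mathieuPotential hp β hk' z
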